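/- Let $N, C$ be integers with $0\le C<N$ and let $w^1,\dots,w^N>0$. Let $\mathcal X=\{x\in\{0,1\}^N:\sum_n x^n=1\}$ (requests) and $\mathcal Y=\{y\in[0,1]^N:\sum_n y^n\le C\}$ (cache configurations, a capped simplex), and let a request $x$ served with configuration $y$ yield the utility $f(x,y)=\sum_{n=1}^N w^n x^n y^n$. A caching policy $\sigma$ is a (possibly randomized) rule that in each slot $t$ chooses $y_t(\sigma)\in\mathcal Y$ from the past requests $x_1,\dots,x_{t-1}$ and the past configurations $y_1,\dots,y_{t-1}$. Its regret over the horizon $T$ is $$R_T(\sigma)=\max_{P(x_1,\dots,x_T)}\mathbb E\Big[\max_{y\in\mathcal Y}\sum_{t=1}^T f(x_t,y)-\sum_{t=1}^T f(x_t,y_t(\sigma))\Big],$$ the outer maximum being over all joint probability distributions $P$ of the requests on $\mathcal X^T$. Put $S=\sum_{n=1}^N 1/w^n$ and let $Z$ be a Gaussian vector in $\mathbb R^N$ with zero mean and covariance matrix $$\Sigma(w)_{ij}=\frac1S\begin{cases} w^i-\frac1S, & i=j,\\ -\frac1S, & i\ne j,\end{cases}$$ and let $Z_{(i)}$ be its $i$-th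 largest entry; each $Z_{(i)}$ is integrable. (1) For every $\varepsilon>0$ there is $T_0$ such that for all $T\ge T_0$ and all caching policies $\sigma$ (which may depend on $T$) $$R_T(\sigma)>\Big(\sum_{i=1}^C\mathbb E[Z_{(i)}]-\varepsilon\Big)\sqrt T .$$ (2) If moreover $1\le C<N/2$, then there is $T_0$ such that for all $T\ge T_0$ and all caching policies $\sigma$ $$R_T(\sigma)>\frac{\max_{\phi}\sum_{k=1}^C\sqrt{w^{\phi(2k-1)}+w^{\phi(2k)}}}{\sqrt{2\pi\sum_{n=1}^N 1/w^n}}\,\sqrt T,$$ where the maximum is over all permutations $\phi$ of $\{1,\dots,N\}$. -/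

import Mathlib

open MeasureTheory ProbabilityTheory Filter

noncomputable section

/-- The set of request vectors: 0-1 vectors indexed by the `N` files with exactly one entry `1`. -/
def requestSet (N : ℕ) : Set (Fin N → ℝ) :=
  {x | (∀ n, x n = 0 ∨ x n = 1) ∧ ∑ n, x n = 1}

/-- The capped simplex: admissible cache configurations for a cache of size `C`. -/
def cacheSet (N C : ℕ) : Set (Fin N → ℝ) :=
  {y | (∀ n, 0 ≤ y n ∧ y n ≤ 1) ∧ ∑ n, y n ≤ (C : ℝ)}

/-- The utility accrued in one slot with request `x` and configuration `y`. -/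
def utility {N : ℕ} (w x y : Fin N → ℝ) : ℝ := ∑ n, w n * x n * y n

/-- A (possibly randomized) caching policy: after `t` slots have elapsed, it draws the next
configuration from a law that depends measurably on the past `t` requests and the past `t`
configurations. -/
structure CachingPolicy (N C : ℕ) where
  rule : (t : ℕ) →
    Kernel ((Fin t → requestSet N) × (Fin t → cacheSet N C)) (cacheSet N C)
  markov : ∀ t, IsMarkovKernel (rule t)

/-- The conditional law of the configurations in slots `1, …, T`, given the requests in these
slots. The last configuration is drawn by the policy from the earlier requests and the earlier
configurations. -/
def CachingPolicy.configKernel {N C : ℕ} (σ : CachingPolicy N C) :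
    (T : ℕ) → Kernel (Fin T → requestSet N) (Fin T → cacheSet N C)
  | 0 => Kernel.const _ (Measure.dirac (fun i => i.elim0))
  | t + 1 =>
    ((((σ.configKernel t).comap
        (fun x : Fin (t + 1) → requestSet N => (fun i : Fin t => x i.castSucc))
        (by fun_prop)) ⊗ₖ
      ((σ.rule t).comap
        (fun p : (Fin (t + 1) → requestSet N) × (Fin t → cacheSet N C) =>
          ((fun i : Fin t => p.1 i.castSucc), p.2))
        (by fun_prop))).map
      (fun q : (Fin t → cacheSet N C) × cacheSet N C =>
        (Fin.snoc q.1 q.2 : Fin (t + 1) → cacheSet N C)))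

theorem measurable_snoc_config {N C : ℕ} (t : ℕ) :
    Measurable (fun q : (Fin t → cacheSet N C) × cacheSet N C =>
      (Fin.snoc q.1 q.2 : Fin (t + 1) → cacheSet N C)) := by
  refine measurable_pi_lambda _ fun i => ?_
  refine Fin.lastCases ?_ (fun j => ?_) i
  · simpa using measurable_snd
  · simp only [Fin.snoc_castSucc]; fun_prop

instance CachingPolicy.isMarkovKernel_configKernel {N C : ℕ} (σ : CachingPolicy N C) (T : ℕ) :
    IsMarkovKernel (σ.configKernel T) := by
  induction T with
  | zero => unfold CachingPolicy.configKernel; infer_instance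
  | succ t ih =>
    have := σ.markov t
    unfold CachingPolicy.configKernel
    exact Kernel.IsMarkovKernel.map _ (measurable_snoc_config t)

/-- The joint law of requests and configurations, when the requests have law `P` and the
configurations are chosen by the policy `σ`. -/
def CachingPolicy.jointLaw {N C : ℕ} (σ : CachingPolicy N C) {T : ℕ}
    (P : ProbabilityMeasure (Fin T → requestSet N)) :
    Measure ((Fin T → requestSet N) × (Fin T → cacheSet N C)) :=
  (P : Measure (Fin T → requestSet N)) ⊗ₘ σ.configKernel T

/-- The utility of the best static configuration in hindsight for the request path `x`. -/
def bestStatic {N : ℕ} (C : ℕ) (w : Fin N → ℝ) {T : ℕ} (x : Fin T → requestSet N) : ℝ :=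
  ⨆ y : cacheSet N C, ∑ t, utility w (x t) y

/-- The expected utility loss of `σ` against the best static configuration in hindsight, when
the requests in slots `1, …, T` have joint law `P`. -/
def expectedRegret {N C : ℕ} (w : Fin N → ℝ) (σ : CachingPolicy N C) {T : ℕ}
    (P : ProbabilityMeasure (Fin T → requestSet N)) : ℝ :=
  ∫ p, (bestStatic C w p.1 - ∑ t, utility w (p.1 t) (p.2 t)) ∂(σ.jointLaw P)

/-- The worst-case static regret of `σ` over horizon `T`: the largest expected loss over all
joint laws of the requests. -/
def regret {N C : ℕ} (w : Fin N → ℝ) (σ : CachingPolicy N C) (T : ℕ) : ℝ :=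
  ⨆ P : ProbabilityMeasure (Fin T → requestSet N), expectedRegret w σ P

/-- `∑ₙ 1 / wⁿ`. -/
def invWeightSum {N : ℕ} (w : Fin N → ℝ) : ℝ := ∑ n, 1 / w n

/-- The covariance matrix `Σ(w)`. -/
def requestCov {N : ℕ} (w : Fin N → ℝ) : Matrix (Fin N) (Fin N) ℝ :=
  Matrix.of fun i j =>
    1 / invWeightSum w * (if i = j then w i - 1 / invWeightSum w else - (1 / invWeightSum w))

/-- For positive weights `Σ(w)` is positive semidefinite, so that it is a covariance matrix. -/
theorem posSemidef_requestCov {N : ℕ} (w : Fin N → ℝ) (hw : ∀ n, 0 < w n) :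
    (requestCov w).PosSemidef := by
  refine Matrix.PosSemidef.of_dotProduct_mulVec_nonneg ?_ fun x => ?_
  · ext i j
    by_cases h : i = j
    · subst h; simp [requestCov]
    · simp [requestCov, h, Ne.symm h]
  · set S := invWeightSum w with hS
    have hS0 : 0 ≤ S := Finset.sum_nonneg fun n _ => by have := hw n; positivity
    have key : star x ⬝ᵥ (requestCov w).mulVec x
        = 1 / S * (∑ i, w i * x i ^ 2 - 1 / S * (∑ i, x i) ^ 2) := by
      have h1 : ∀ i, (requestCov w).mulVec x i = 1 / S * (w i * x i - 1 / S * ∑ j, x j) := by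
        intro i
        have h2 : ∀ j, requestCov w i j * x j
            = (if i = j then 1 / S * (w i * x j) else 0) - 1 / S * (1 / S) * x j := by
          intro j
          simp only [requestCov, Matrix.of_apply, ← hS]
          split_ifs <;> ring
        simp only [Matrix.mulVec, dotProduct, h2, Finset.sum_sub_distrib, Finset.sum_ite_eq,
          Finset.mem_univ, if_true, ← Finset.mul_sum]
        ring
      simp only [dotProduct, h1, star_trivial]
      have h3 : ∀ i, x i * (1 / S * (w i * x i - 1 / S * ∑ j, x j))
          = 1 / S * (w i * x i ^ 2) - 1 / S * (1 / S * (∑ j, x j)) * x i := fun i => by ring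
      simp only [h3, Finset.sum_sub_distrib, ← Finset.mul_sum]
      ring
    rw [key]
    have cs : (∑ i, x i) ^ 2 ≤ S * ∑ i, w i * x i ^ 2 :=
      Finset.sum_sq_le_sum_mul_sum_of_sq_le_mul _ (fun i _ => by have := hw i; positivity)
        (fun i _ => by have := hw i; positivity)
        (fun i _ => by have := (hw i).ne'; field_simp; exact le_rfl)
    refine mul_nonneg (by positivity) (sub_nonneg.2 ?_)
    rcases hS0.eq_or_lt with h | h
    · rw [← h]; simpa using Finset.sum_nonneg fun i _ => mul_nonneg (hw i).le (sq_nonneg (x i))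
    · rw [one_div, inv_mul_le_iff₀ h]; exact cs

/-- The law of the Gaussian vector with zero mean and covariance matrix `Σ(w)`. -/
def limitGaussian {N : ℕ} (w : Fin N → ℝ) : Measure (EuclideanSpace ℝ (Fin N)) :=
  multivariateGaussian 0 (requestCov w)

/-- The `(i + 1)`-th largest entry of `z`, for `i = 0, …, N - 1` (`Tuple.sort z` arranges the
entries in increasing order). -/
def kthLargest {N : ℕ} (z : EuclideanSpace ℝ (Fin N)) (i : Fin N) : ℝ :=
  z (Tuple.sort (fun n => z n) i.rev)

/-- The sum `∑ₖ √(w^{φ(2k-1)} + w^{φ(2k)})`, `k = 1, …, C`, with files and `k` numbered from 0. -/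
def pairSum {N C : ℕ} (w : Fin N → ℝ) (h : 2 * C < N) (φ : Equiv.Perm (Fin N)) : ℝ :=
  ∑ k : Fin C, √(w (φ ⟨2 * (k : ℕ), by omega⟩) + w (φ ⟨2 * (k : ℕ) + 1, by omega⟩))

end

/-! The regret is at least the expected loss under any one request law. Take independent requests,
file `n` having probability `(1 / w n) / S`. Then every weighted coordinate `w n * x n` has mean `1
/ S`, so no rule based on the past earns more than `C / S` per slot on average
(`integral_sum_utility_balanced_le`). In hindsight one may cache the `C` files with the largest
weighted counts. The centring of the counts cancels the policy's bound, and `√T` times the mean of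
`topSum` of the scaled counts remains as a lower bound, the same for all policies
(`sqrt_mul_integral_topSum_le_regret`).

The scaled counts converge in law to the Gaussian vector (`tendsto_scaledCountsLaw`), and their
bounded second moments carry this over to the means of `topSum`
(`tendsto_integral_topSum_scaledCounts`). Hence every constant below the Gaussian mean of `topSum`
is eventually beaten, which is the first bound.

For the second, `topSum` dominates the sum of the maxima over `C` disjoint pairs, whose mean is
explicit because `Z a - Z b` is Gaussian with variance `(w a + w b) / S`. As `2 * C < N`, a file
outside the pairs exceeds both members of one pair with positive probability. The domination of
means is therefore strict (`integral_pairMaxSum_lt`), which leaves the gap that the limit needs. -/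

/-! ### Order statistics and sums of largest entries -/

/-- After subtracting the threshold value `c`, terms with index below `C` are nonnegative and the
others nonpositive; the subtracted totals agree because the cardinalities do. -/
theorem Finset.sum_le_sum_map_castLE_of_antitone {N C : ℕ} (h : C ≤ N) {a : Fin N → ℝ}
    (ha : Antitone a) (B : Finset (Fin N)) (hB : B.card = C) :
    ∑ j ∈ B, a j ≤ ∑ i : Fin C, a (Fin.castLE h i) := by
  classical
  rcases Nat.eq_zero_or_pos C with rfl | hC
  · simp [Finset.card_eq_zero.1 hB]
  set F : Finset (Fin N) := Finset.univ.map (Fin.castLEEmb h) with hF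
  have hsum : ∑ i : Fin C, a (Fin.castLE h i) = ∑ j ∈ F, a j := by simp [hF]
  have hmem : ∀ j, j ∈ F ↔ (j : ℕ) < C := by
    intro j
    simp only [hF, Finset.mem_map, Finset.mem_univ, true_and]
    constructor
    · rintro ⟨i, rfl⟩; exact i.2
    · intro hj; exact ⟨⟨j, hj⟩, by ext; simp⟩
  have hFcard : F.card = C := by simp [hF]
  set c := a ⟨C - 1, by omega⟩ with hc
  have h1 : ∀ j ∈ F, 0 ≤ a j - c := fun j hj => by
    have := (hmem j).1 hj
    exact sub_nonneg.2 (ha (Fin.le_def.2 (by simp; omega)))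
  have h2 : ∀ j, j ∉ F → a j - c ≤ 0 := fun j hj => by
    have := mt (hmem j).2 hj
    exact sub_nonpos.2 (ha (Fin.le_def.2 (by simp; omega)))
  have h3 : ∑ j ∈ B, (a j - c) ≤ ∑ j ∈ F, (a j - c) := by
    rw [← Finset.sum_filter_add_sum_filter_not B (· ∈ F)]
    have e1 : ∑ j ∈ B with j ∉ F, (a j - c) ≤ 0 :=
      Finset.sum_nonpos fun j hj => h2 j (Finset.mem_filter.1 hj).2
    have e2 : ∑ j ∈ B with j ∈ F, (a j - c) ≤ ∑ j ∈ F, (a j - c) :=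
      Finset.sum_le_sum_of_subset_of_nonneg (fun j hj => (Finset.mem_filter.1 hj).2)
        fun j hj _ => h1 j hj
    linarith
  rw [hsum]
  simpa [Finset.sum_sub_distrib, hB, hFcard] using h3

/-- The sum of the `C` largest entries of `z`. -/
noncomputable def topSum {N C : ℕ} (h : C ≤ N) (z : EuclideanSpace ℝ (Fin N)) : ℝ :=
  ∑ i : Fin C, kthLargest z (Fin.castLE h i)

theorem antitone_kthLargest {N : ℕ} (z : EuclideanSpace ℝ (Fin N)) : Antitone (kthLargest z) :=
  fun _ _ hij => Tuple.monotone_sort (fun n => z n) (Fin.rev_le_rev.2 hij)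

theorem sum_le_topSum {N C : ℕ} (h : C ≤ N) (z : EuclideanSpace ℝ (Fin N))
    (A : Finset (Fin N)) (hA : A.card = C) : ∑ n ∈ A, z n ≤ topSum h z := by
  set e : Equiv.Perm (Fin N) := Fin.revPerm.trans (Tuple.sort fun n => z n) with he
  have h1 : ∑ n ∈ A, z n = ∑ j ∈ A.map e.symm.toEmbedding, kthLargest z j := by
    rw [Finset.sum_map]
    refine Finset.sum_congr rfl fun n _ => ?_
    change z n = z (e (e.symm n))
    rw [Equiv.apply_symm_apply]
  rw [h1]
  exact Finset.sum_le_sum_map_castLE_of_antitone h (antitone_kthLargest z) _ (by simpa using hA)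

theorem exists_sum_eq_topSum {N C : ℕ} (h : C ≤ N) (z : EuclideanSpace ℝ (Fin N)) :
    ∃ A : Finset (Fin N), A.card = C ∧ ∑ n ∈ A, z n = topSum h z := by
  set e : Equiv.Perm (Fin N) := Fin.revPerm.trans (Tuple.sort fun n => z n) with he
  refine ⟨Finset.univ.map ((Fin.castLEEmb h).trans e.toEmbedding), by simp, ?_⟩
  rw [Finset.sum_map]
  rfl

theorem sum_comp_le_topSum {N C : ℕ} (h : C ≤ N) (z : EuclideanSpace ℝ (Fin N))
    (f : Fin C → Fin N) (hf : Function.Injective f) : ∑ k, z (f k) ≤ topSum h z := by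
  have := sum_le_topSum h z (Finset.univ.map ⟨f, hf⟩) (by simp)
  simpa using this

theorem abs_topSum_le {N C : ℕ} (h : C ≤ N) (z : EuclideanSpace ℝ (Fin N)) :
    |topSum h z| ≤ ∑ n, |z n| := by
  obtain ⟨A, -, hA⟩ := exists_sum_eq_topSum h z
  rw [← hA]
  exact (Finset.abs_sum_le_sum_abs _ _).trans
    (Finset.sum_le_sum_of_subset_of_nonneg (Finset.subset_univ _) fun _ _ _ => abs_nonneg _)

theorem topSum_sq_le {N C : ℕ} (h : C ≤ N) (z : EuclideanSpace ℝ (Fin N)) :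
    topSum h z ^ 2 ≤ N * ∑ n, z n ^ 2 := by
  have h1 : topSum h z ^ 2 ≤ (∑ n, |z n|) ^ 2 := sq_le_sq' (abs_le.1 (abs_topSum_le h z)).1
    (abs_le.1 (abs_topSum_le h z)).2
  refine h1.trans ?_
  have := sq_sum_le_card_mul_sum_sq (s := Finset.univ) (f := fun n => |z n|)
  simpa using this

/-- A maximum of finitely many linear functionals, one for each `C`-element set. -/
theorem continuous_topSum {N C : ℕ} (h : C ≤ N) :
    Continuous (topSum h : EuclideanSpace ℝ (Fin N) → ℝ) := by
  have hne : (Finset.powersetCard C (Finset.univ : Finset (Fin N))).Nonempty :=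
    Finset.powersetCard_nonempty.2 (by simpa using h)
  have : (topSum h : EuclideanSpace ℝ (Fin N) → ℝ) = fun z =>
      (Finset.powersetCard C Finset.univ).sup' hne fun A => ∑ n ∈ A, z n := by
    funext z
    refine le_antisymm ?_ (Finset.sup'_le _ _ fun A hA =>
      sum_le_topSum h z A (Finset.mem_powersetCard.1 hA).2)
    obtain ⟨A, hA, hs⟩ := exists_sum_eq_topSum h z
    rw [← hs]
    exact Finset.le_sup' (fun A => ∑ n ∈ A, z n)
      (Finset.mem_powersetCard.2 ⟨Finset.subset_univ _, hA⟩)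
  rw [this]
  exact Continuous.finset_sup'_apply hne fun A _ => by fun_prop

theorem kthLargest_eq_topSum_sub {N : ℕ} (z : EuclideanSpace ℝ (Fin N)) (i : Fin N) :
    kthLargest z i = topSum (C := i + 1) i.2 z - topSum i.2.le z := by
  unfold topSum
  rw [Fin.sum_univ_castSucc]
  have : Fin.castLE i.2 (Fin.last (i : ℕ)) = i := by ext; simp
  rw [this]
  simp [Fin.castLE]

theorem continuous_kthLargest {N : ℕ} (i : Fin N) :
    Continuous fun z : EuclideanSpace ℝ (Fin N) => kthLargest z i := by
  simp_rw [kthLargest_eq_topSum_sub]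
  exact (continuous_topSum _).sub (continuous_topSum _)

theorem abs_kthLargest_le_norm {N : ℕ} (z : EuclideanSpace ℝ (Fin N)) (i : Fin N) :
    |kthLargest z i| ≤ ‖z‖ :=
  PiLp.norm_apply_le z _

/-! ### Maxima over disjoint pairs -/

/-- The sum of the maxima of `z` over the pairs `φ (2k), φ (2k + 1)`. -/
noncomputable def pairMaxSum {N C : ℕ} (h : 2 * C < N) (φ : Equiv.Perm (Fin N))
    (z : EuclideanSpace ℝ (Fin N)) : ℝ :=
  ∑ k : Fin C, max (z (φ ⟨2 * (k : ℕ), by omega⟩)) (z (φ ⟨2 * (k : ℕ) + 1, by omega⟩))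

/-- Halving a position recovers the number of its pair, which makes the selection of maximizers
injective. -/
theorem exists_pairMaxSum_eq {N C : ℕ} (h : 2 * C < N) (φ : Equiv.Perm (Fin N))
    (z : EuclideanSpace ℝ (Fin N)) :
    ∃ g : Fin C → Fin N, (∀ k, (g k : ℕ) / 2 = k) ∧
      ∀ k, z (φ (g k)) =
        max (z (φ ⟨2 * (k : ℕ), by omega⟩)) (z (φ ⟨2 * (k : ℕ) + 1, by omega⟩)) := by
  have : ∀ k : Fin C, ∃ j : Fin N, (j : ℕ) / 2 = k ∧ z (φ j) =
      max (z (φ ⟨2 * (k : ℕ), by omega⟩)) (z (φ ⟨2 * (k : ℕ) + 1, by omega⟩)) := by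
    intro k
    rcases le_total (z (φ ⟨2 * (k : ℕ), by omega⟩)) (z (φ ⟨2 * (k : ℕ) + 1, by omega⟩)) with hk | hk
    · exact ⟨⟨2 * (k : ℕ) + 1, by omega⟩, by simp only; omega, (max_eq_right hk).symm⟩
    · exact ⟨⟨2 * (k : ℕ), by omega⟩, by simp only; omega, (max_eq_left hk).symm⟩
  choose g hg hz using this
  exact ⟨g, hg, hz⟩

theorem pairMaxSum_le_topSum {N C : ℕ} (hCN : C ≤ N) (h : 2 * C < N) (φ : Equiv.Perm (Fin N))
    (z : EuclideanSpace ℝ (Fin N)) : pairMaxSum h φ z ≤ topSum hCN z := by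
  obtain ⟨g, hg, hz⟩ := exists_pairMaxSum_eq h φ z
  have hinj : Function.Injective fun k => φ (g k) := fun a b hab => by
    have := congrArg (fun j : Fin N => (j : ℕ) / 2) (φ.injective hab)
    simp only [hg] at this
    exact Fin.ext this
  refine le_trans (le_of_eq ?_) (sum_comp_le_topSum hCN z _ hinj)
  exact Finset.sum_congr rfl fun k _ => (hz k).symm

/-- Exchange the maximizer of pair `0` for the spare position `2 * C`; half of that is `C`, no
pair's number, so the selection stays injective. -/
theorem pairMaxSum_lt_topSum {N C : ℕ} (hCN : C ≤ N) (h : 2 * C < N) (hC : 0 < C)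
    (φ : Equiv.Perm (Fin N)) (z : EuclideanSpace ℝ (Fin N))
    (h0 : z (φ ⟨0, by omega⟩) < z (φ ⟨2 * C, h⟩)) (h1 : z (φ ⟨1, by omega⟩) < z (φ ⟨2 * C, h⟩)) :
    pairMaxSum h φ z < topSum hCN z := by
  obtain ⟨g, hg, hz⟩ := exists_pairMaxSum_eq h φ z
  set k0 : Fin C := ⟨0, hC⟩ with hk0
  set g' : Fin C → Fin N := Function.update g k0 ⟨2 * C, h⟩ with hg'
  have hinj : Function.Injective fun k => φ (g' k) := fun a b hab => by
    have hab' := congrArg (fun j : Fin N => (j : ℕ) / 2) (φ.injective hab)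
    by_cases ha : a = k0 <;> by_cases hb : b = k0
    · rw [ha, hb]
    · simp [hg', ha, Function.update_of_ne hb, hg] at hab'
      have := b.2; omega
    · simp [hg', hb, Function.update_of_ne ha, hg] at hab'
      have := a.2; omega
    · simp only [hg', Function.update_of_ne ha, Function.update_of_ne hb, hg] at hab'
      exact Fin.ext hab'
  refine lt_of_lt_of_le ?_ (sum_comp_le_topSum hCN z _ hinj)
  refine Finset.sum_lt_sum (fun k _ => ?_) ⟨k0, Finset.mem_univ _, ?_⟩
  · by_cases hk : k = k0
    · rw [hk, hg', Function.update_self]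
      exact (max_lt h0 h1).le
    · rw [hg', Function.update_of_ne hk]
      exact (hz k).ge
  · rw [hg', Function.update_self]
    exact max_lt h0 h1

/-! ### The limiting Gaussian vector -/

theorem integral_abs_gaussianReal (v : NNReal) :
    ∫ x, |x| ∂(gaussianReal 0 v) = √(2 * v / Real.pi) := by
  rcases eq_or_ne v 0 with rfl | hv
  · simp
  have hv0 : (0 : ℝ) < v := by exact_mod_cast pos_iff_ne_zero.2 hv
  rw [integral_gaussianReal_eq_integral_smul hv]
  have h1 : ∀ x : ℝ, gaussianPDFReal 0 v x • |x| =
      (√(2 * Real.pi * v))⁻¹ * (fun u : ℝ => u * Real.exp (-(2 * (v : ℝ))⁻¹ * u ^ 2)) |x| := by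
    intro x
    simp only [gaussianPDFReal, smul_eq_mul, sub_zero, sq_abs]
    rw [show -(2 * (v : ℝ))⁻¹ * x ^ 2 = -x ^ 2 / (2 * v) by field_simp]
    ring
  simp_rw [h1]
  rw [integral_const_mul, integral_comp_abs (f := fun u : ℝ => u * Real.exp (-(2 * (v : ℝ))⁻¹ * u ^ 2))]
  have h2 : ∫ u in Set.Ioi (0 : ℝ), u * Real.exp (-(2 * (v : ℝ))⁻¹ * u ^ 2) = v := by
    have := integral_rpow_mul_exp_neg_mul_rpow (p := 2) (q := 1) (b := (2 * (v : ℝ))⁻¹) two_pos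
      (by norm_num) (by positivity)
    simp only [Real.rpow_one, Real.rpow_two] at this
    rw [this]
    norm_num [Real.Gamma_one]
    rw [Real.rpow_neg_one]; field_simp
  rw [h2]
  have h3 : √(2 * Real.pi * v) ≠ 0 := by positivity
  have h4 : √(2 * v / Real.pi) * √(2 * Real.pi * v) = 2 * v := by
    rw [← Real.sqrt_mul (by positivity), Real.sqrt_eq_iff_mul_self_eq (by positivity)
      (by positivity)]
    field_simp
  field_simp
  linarith

instance isGaussian_limitGaussian {N : ℕ} (w : Fin N → ℝ) : IsGaussian (limitGaussian w) := by
  unfold limitGaussian; infer_instance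

theorem memLp_two_eval_limitGaussian {N : ℕ} (w : Fin N → ℝ) (i : Fin N) :
    MemLp (fun z : EuclideanSpace ℝ (Fin N) => z i) 2 (limitGaussian w) :=
  (IsGaussian.memLp_two_id (μ := limitGaussian w)).continuousLinearMap_comp
    (EuclideanSpace.proj (𝕜 := ℝ) i)

theorem integral_eval_limitGaussian {N : ℕ} (w : Fin N → ℝ) (i : Fin N) :
    ∫ z, z i ∂(limitGaussian w) = 0 := by
  have h := (EuclideanSpace.proj (𝕜 := ℝ) i).integral_comp_comm
    (IsGaussian.integrable_id (μ := limitGaussian w))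
  simp only [id, PiLp.proj_apply] at h
  rw [h, limitGaussian, integral_id_multivariateGaussian]
  simp

theorem covariance_eval_limitGaussian {N : ℕ} {w : Fin N → ℝ} (hw : ∀ n, 0 < w n) (i j : Fin N) :
    cov[fun z => z i, fun z => z j; limitGaussian w] = requestCov w i j :=
  covariance_eval_multivariateGaussian (posSemidef_requestCov w hw) i j

theorem covariance_sub_sub_limitGaussian {N : ℕ} {w : Fin N → ℝ} (hw : ∀ n, 0 < w n)
    (a b c d : Fin N) :
    cov[fun z => z a - z b, fun z => z c - z d; limitGaussian w] =
      requestCov w a c - requestCov w a d - requestCov w b c + requestCov w b d := by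
  have m := memLp_two_eval_limitGaussian w
  have := covariance_sub_sub (m a) (m b) (m c) (m d)
  simp only [covariance_eval_limitGaussian hw] at this
  exact this

theorem map_neg_limitGaussian {N : ℕ} {w : Fin N → ℝ} (hw : ∀ n, 0 < w n) :
    (limitGaussian w).map (fun z => -z) = limitGaussian w := by
  have : IsProbabilityMeasure ((limitGaussian w).map (fun z => -z)) :=
    Measure.isProbabilityMeasure_map (by fun_prop)
  refine Measure.ext_of_charFun ?_
  ext t
  have h := charFun_map_smul (μ := limitGaussian w) (-1) t
  simp only [neg_smul, one_smul] at h
  rw [h]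
  simp only [limitGaussian, charFun_multivariateGaussian (posSemidef_requestCov w hw)]
  simp [Matrix.mulVec_neg]

theorem map_eval_sub_limitGaussian {N : ℕ} {w : Fin N → ℝ} (hw : ∀ n, 0 < w n) {a b : Fin N}
    (hab : a ≠ b) :
    (limitGaussian w).map (fun z => z a - z b) =
      gaussianReal 0 ((w a + w b) / invWeightSum w).toNNReal := by
  have h := IsGaussian.map_eq_gaussianReal (μ := limitGaussian w)
    (EuclideanSpace.proj (𝕜 := ℝ) a - EuclideanSpace.proj (𝕜 := ℝ) b)
  have e : ⇑(EuclideanSpace.proj (𝕜 := ℝ) a - EuclideanSpace.proj (𝕜 := ℝ) b :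
      EuclideanSpace ℝ (Fin N) →L[ℝ] ℝ) = fun z => z a - z b := by ext z; simp
  rw [e] at h
  have m := memLp_two_eval_limitGaussian w
  rw [h, integral_sub ((m a).integrable one_le_two) ((m b).integrable one_le_two),
    integral_eval_limitGaussian, integral_eval_limitGaussian, sub_zero,
    ← covariance_self (by fun_prop), covariance_sub_sub_limitGaussian hw]
  congr 2
  simp only [requestCov, Matrix.of_apply, if_true, if_neg hab, if_neg hab.symm]
  ring

theorem integral_max_eval_limitGaussian {N : ℕ} {w : Fin N → ℝ} (hw : ∀ n, 0 < w n) {a b : Fin N}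
    (hab : a ≠ b) :
    ∫ z, max (z a) (z b) ∂(limitGaussian w) =
      √(w a + w b) / √(2 * Real.pi * invWeightSum w) := by
  have m := fun i => (memLp_two_eval_limitGaussian w i).integrable one_le_two
  have hS : 0 < invWeightSum w :=
    Finset.sum_pos (fun n _ => one_div_pos.2 (hw n)) ⟨a, Finset.mem_univ a⟩
  have hab0 : 0 < w a + w b := add_pos (hw a) (hw b)
  have h1 : ∫ z, |z a - z b| ∂(limitGaussian w) =
      √(2 * ((w a + w b) / invWeightSum w) / Real.pi) := by
    have h := integral_map (μ := limitGaussian w) (φ := fun z => z a - z b) (by fun_prop)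
      (f := fun x : ℝ => |x|) (by fun_prop)
    rw [← h, map_eval_sub_limitGaussian hw hab, integral_abs_gaussianReal,
      Real.coe_toNNReal _ (by positivity)]
  have h2 : ∀ z : EuclideanSpace ℝ (Fin N),
      max (z a) (z b) = 2⁻¹ * (z a + z b + |z a - z b|) := fun z => by
    rw [abs_sub_comm, ← smul_eq_mul]
    exact sup_eq_half_smul_add_add_abs_sub' ℝ (z a) (z b)
  simp_rw [h2]
  have h3 : ∫ z, (z a + z b + |z a - z b|) ∂(limitGaussian w) =
      ∫ z, (z a + z b) ∂(limitGaussian w) + ∫ z, |z a - z b| ∂(limitGaussian w) :=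
    integral_add ((m a).add (m b)) ((m a).sub (m b)).abs
  rw [integral_const_mul, h3, integral_add (m a) (m b), integral_eval_limitGaussian, integral_eval_limitGaussian, h1,
    ← Real.sqrt_div hab0.le, eq_comm, Real.sqrt_eq_iff_mul_self_eq (by positivity) (by positivity)]
  rw [zero_add, zero_add, mul_mul_mul_comm, Real.mul_self_sqrt (by positivity)]
  field_simp

theorem integrable_topSum {N C : ℕ} (h : C ≤ N) (w : Fin N → ℝ) :
    Integrable (topSum h) (limitGaussian w) := by
  have m := fun i => (memLp_two_eval_limitGaussian w i).integrable one_le_two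
  refine (integrable_finsetSum Finset.univ fun n _ => (m n).abs).mono'
    (continuous_topSum h).aestronglyMeasurable (ae_of_all _ fun z => ?_)
  simpa using abs_topSum_le h z

theorem integrable_topSum_sq {N C : ℕ} (h : C ≤ N) (w : Fin N → ℝ) :
    Integrable (fun z => topSum h z ^ 2) (limitGaussian w) := by
  have m := fun i => (memLp_two_eval_limitGaussian w i).integrable_sq
  refine ((integrable_finsetSum Finset.univ fun n _ => m n).const_mul (N : ℝ)).mono'
    ((continuous_topSum h).pow 2).aestronglyMeasurable (ae_of_all _ fun z => ?_)
  simpa using topSum_sq_le h z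

theorem integrable_kthLargest {N : ℕ} (w : Fin N → ℝ) (i : Fin N) :
    Integrable (fun z => kthLargest z i) (limitGaussian w) := by
  refine (IsGaussian.integrable_id (μ := limitGaussian w)).norm.mono'
    (continuous_kthLargest i).aestronglyMeasurable (ae_of_all _ fun z => ?_)
  exact abs_kthLargest_le_norm z i

theorem integrable_max_eval_limitGaussian {N : ℕ} (w : Fin N → ℝ) (a b : Fin N) :
    Integrable (fun z => max (z a) (z b)) (limitGaussian w) :=
  ((memLp_two_eval_limitGaussian w a).integrable one_le_two).sup
    ((memLp_two_eval_limitGaussian w b).integrable one_le_two)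

theorem integrable_pairMaxSum {N C : ℕ} (h : 2 * C < N) (w : Fin N → ℝ)
    (φ : Equiv.Perm (Fin N)) : Integrable (pairMaxSum h φ) (limitGaussian w) :=
  integrable_finsetSum Finset.univ fun _ _ => integrable_max_eval_limitGaussian w _ _

theorem integral_pairMaxSum {N C : ℕ} (h : 2 * C < N) {w : Fin N → ℝ} (hw : ∀ n, 0 < w n)
    (φ : Equiv.Perm (Fin N)) :
    ∫ z, pairMaxSum h φ z ∂(limitGaussian w) =
      pairSum w h φ / √(2 * Real.pi * invWeightSum w) := by
  unfold pairMaxSum pairSum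
  rw [integral_finsetSum _ (by exact fun k _ => integrable_max_eval_limitGaussian w _ _),
    Finset.sum_div]
  refine Finset.sum_congr rfl fun k _ => integral_max_eval_limitGaussian hw fun hk => ?_
  have := congrArg Fin.val (φ.injective hk)
  simp at this

/-- Otherwise, by the symmetry `z ↦ -z`, almost surely `z e` is also not below both of the others,
so `(z e - z a) * (z e - z b) ≤ 0`. But the mean of this product is a covariance, `w e / S > 0`. No
density is needed, which matters since the covariance matrix is singular. -/
theorem not_ae_not_both_lt {N : ℕ} {w : Fin N → ℝ} (hw : ∀ n, 0 < w n) {a b e : Fin N}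
    (hab : a ≠ b) (hae : a ≠ e) (hbe : b ≠ e) :
    ¬ ∀ᵐ z ∂(limitGaussian w), ¬ (z a < z e ∧ z b < z e) := by
  intro hneg
  have m := fun i => memLp_two_eval_limitGaussian w i
  have hS : 0 < invWeightSum w :=
    Finset.sum_pos (fun n _ => one_div_pos.2 (hw n)) ⟨a, Finset.mem_univ a⟩
  have hneg' : ∀ᵐ z ∂(limitGaussian w), ¬ (z e < z a ∧ z e < z b) := by
    have h := hneg
    rw [← map_neg_limitGaussian hw] at h
    have h' := ae_of_ae_map (by fun_prop) h
    filter_upwards [h'] with z hz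
    simpa using hz
  have hcov : cov[fun z => z e - z a, fun z => z e - z b; limitGaussian w]
      = w e / invWeightSum w := by
    rw [covariance_sub_sub_limitGaussian hw]
    simp only [requestCov, Matrix.of_apply, if_true, if_neg hab, if_neg hae, if_neg hbe.symm]
    ring
  have m1 : ∀ i j : Fin N, ∫ z, (z i - z j) ∂(limitGaussian w) = 0 := fun i j => by
    rw [integral_sub ((m i).integrable one_le_two) ((m j).integrable one_le_two),
      integral_eval_limitGaussian, integral_eval_limitGaussian, sub_zero]
  rw [show cov[fun z => z e - z a, fun z => z e - z b; limitGaussian w] = _ from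
    covariance_eq_sub ((m e).sub (m a)) ((m e).sub (m b))] at hcov
  simp only [Pi.mul_apply, m1, zero_mul, sub_zero] at hcov
  have hle : ∫ z, (z e - z a) * (z e - z b) ∂(limitGaussian w) ≤ 0 := by
    refine integral_nonpos_of_ae ?_
    filter_upwards [hneg, hneg'] with z h1 h2
    by_contra hc
    rw [not_le] at hc
    rcases mul_pos_iff.1 hc with h | h
    · exact h1 ⟨by linarith [h.1], by linarith [h.2]⟩
    · exact h2 ⟨by linarith [h.1], by linarith [h.2]⟩
  have hpos : 0 < w e / invWeightSum w := div_pos (hw e) hS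
  linarith

theorem integral_pairMaxSum_lt {N C : ℕ} (hCN : C ≤ N) (h : 2 * C < N) (hC : 0 < C)
    {w : Fin N → ℝ} (hw : ∀ n, 0 < w n) (φ : Equiv.Perm (Fin N)) :
    ∫ z, pairMaxSum h φ z ∂(limitGaussian w) < ∫ z, topSum hCN z ∂(limitGaussian w) := by
  have i1 := integrable_pairMaxSum h w φ
  have i2 := integrable_topSum hCN w
  refine lt_of_le_of_ne (integral_mono i1 i2 (pairMaxSum_le_topSum hCN h φ)) fun heq => ?_
  have hz : ∫ z, (topSum hCN z - pairMaxSum h φ z) ∂(limitGaussian w) = 0 := by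
    rw [integral_sub i2 i1, heq, sub_self]
  rw [integral_eq_zero_iff_of_nonneg
    (fun z => sub_nonneg.2 (pairMaxSum_le_topSum hCN h φ z)) (i2.sub i1)] at hz
  have hne : ∀ i j : Fin N, (i : ℕ) ≠ j → φ i ≠ φ j := fun i j hij he =>
    hij (congrArg Fin.val (φ.injective he))
  refine not_ae_not_both_lt hw (a := φ ⟨0, by omega⟩) (b := φ ⟨1, by omega⟩) (e := φ ⟨2 * C, h⟩)
    (hne _ _ (by simp)) (hne _ _ (by simp; omega)) (hne _ _ (by simp; omega)) ?_
  filter_upwards [hz] with z h0 hlt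
  have := pairMaxSum_lt_topSum hCN h hC φ z hlt.1 hlt.2
  simp only [Pi.zero_apply] at h0
  linarith

/-! ### Balanced requests and their moments -/

theorem finite_requestSet (N : ℕ) : (requestSet N).Finite :=
  (Set.Finite.pi' fun _ : Fin N => Set.toFinite ({0, 1} : Set ℝ)).subset fun x hx n => by
    simpa using hx.1 n

instance finite_coe_requestSet (N : ℕ) : Finite (requestSet N) := finite_requestSet N

/-- The request for the file `n`. -/
def unitRequest {N : ℕ} (n : Fin N) : requestSet N :=
  ⟨Pi.single n 1, fun m => by
    rcases eq_or_ne m n with rfl | h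
    · simp
    · simp [h], by simp⟩

/-- The law of a request in which each file is requested with probability inversely proportional
to its weight. -/
noncomputable def balancedRequest {N : ℕ} (w : Fin N → ℝ) : Measure (requestSet N) :=
  ∑ n, ENNReal.ofReal (1 / w n / invWeightSum w) • Measure.dirac (unitRequest n)

theorem invWeightSum_pos {N : ℕ} (hN : 0 < N) {w : Fin N → ℝ} (hw : ∀ n, 0 < w n) :
    0 < invWeightSum w :=
  Finset.sum_pos (fun n _ => one_div_pos.2 (hw n)) ⟨⟨0, hN⟩, Finset.mem_univ _⟩

theorem isProbabilityMeasure_balancedRequest {N : ℕ} (hN : 0 < N) {w : Fin N → ℝ}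
    (hw : ∀ n, 0 < w n) : IsProbabilityMeasure (balancedRequest w) := by
  have hS := invWeightSum_pos hN hw
  refine ⟨?_⟩
  simp only [balancedRequest, Measure.coe_finsetSum, Finset.sum_apply, Measure.smul_apply,
    measure_univ, smul_eq_mul, mul_one]
  rw [← ENNReal.ofReal_sum_of_nonneg fun n _ => by have := hw n; positivity, ← Finset.sum_div]
  change ENNReal.ofReal (invWeightSum w / invWeightSum w) = 1
  rw [div_self hS.ne', ENNReal.ofReal_one]

theorem integral_balancedRequest {N : ℕ} {w : Fin N → ℝ} (hw : ∀ n, 0 < w n)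
    (f : requestSet N → ℝ) :
    ∫ x, f x ∂(balancedRequest w) = ∑ n, 1 / w n / invWeightSum w * f (unitRequest n) := by
  have hS : 0 ≤ invWeightSum w := Finset.sum_nonneg fun n _ => (one_div_pos.2 (hw n)).le
  rw [balancedRequest, integral_finsetSum_measure]
  · refine Finset.sum_congr rfl fun n _ => ?_
    rw [integral_smul_measure, integral_dirac, ENNReal.toReal_ofReal, smul_eq_mul]
    have := hw n
    positivity
  · intro n _
    exact Integrable.smul_measure (integrable_dirac (by simp)) ENNReal.ofReal_ne_top

theorem integral_linear_balancedRequest {N : ℕ} {w : Fin N → ℝ} (hw : ∀ n, 0 < w n)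
    (t : Fin N → ℝ) :
    ∫ x : requestSet N, ∑ n, t n * (w n * x.1 n) ∂(balancedRequest w) =
      1 / invWeightSum w * ∑ n, t n := by
  rw [integral_balancedRequest hw, Finset.mul_sum]
  refine Finset.sum_congr rfl fun n _ => ?_
  have h : ∑ m, t m * (w m * (unitRequest n).1 m) = t n * w n := by
    simp [unitRequest, Pi.single_apply]
  rw [h]
  have := (hw n).ne'
  field_simp

theorem integral_linear_sq_balancedRequest {N : ℕ} {w : Fin N → ℝ} (hw : ∀ n, 0 < w n)
    (t : Fin N → ℝ) :
    ∫ x : requestSet N, (∑ n, t n * (w n * x.1 n)) ^ 2 ∂(balancedRequest w) =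
      1 / invWeightSum w * ∑ n, w n * t n ^ 2 := by
  rw [integral_balancedRequest hw, Finset.mul_sum]
  refine Finset.sum_congr rfl fun n _ => ?_
  have h : ∑ m, t m * (w m * (unitRequest n).1 m) = t n * w n := by
    simp [unitRequest, Pi.single_apply]
  rw [h]
  have := (hw n).ne'
  field_simp

/-- The right side has the shape second moment minus squared mean, to be matched with a balanced
request. -/
theorem dotProduct_requestCov_mulVec {N : ℕ} (w t : Fin N → ℝ) :
    t ⬝ᵥ (requestCov w).mulVec t =
      1 / invWeightSum w * ∑ n, w n * t n ^ 2 - (1 / invWeightSum w * ∑ n, t n) ^ 2 := by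
  have h1 : ∀ i, (requestCov w).mulVec t i =
      1 / invWeightSum w * (w i * t i - 1 / invWeightSum w * ∑ j, t j) := by
    intro i
    have h2 : ∀ j, requestCov w i j * t j =
        (if i = j then 1 / invWeightSum w * (w i * t j) else 0)
          - 1 / invWeightSum w * (1 / invWeightSum w) * t j := by
      intro j
      simp only [requestCov, Matrix.of_apply]
      split_ifs <;> ring
    simp only [Matrix.mulVec, dotProduct, h2, Finset.sum_sub_distrib, Finset.sum_ite_eq,
      Finset.mem_univ, if_true, ← Finset.mul_sum]
    ring
  have h3 : ∀ i, t i * (1 / invWeightSum w * (w i * t i - 1 / invWeightSum w * ∑ j, t j)) =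
      1 / invWeightSum w * (w i * t i ^ 2)
        - 1 / invWeightSum w * (1 / invWeightSum w * (∑ j, t j)) * t i := fun i => by ring
  simp only [dotProduct, h1, h3, Finset.sum_sub_distrib, ← Finset.mul_sum]
  ring

theorem variance_linear_balancedRequest {N : ℕ} (hN : 0 < N) {w : Fin N → ℝ} (hw : ∀ n, 0 < w n)
    (t : Fin N → ℝ) :
    Var[fun x : requestSet N => ∑ n, t n * (w n * x.1 n); balancedRequest w] =
      t ⬝ᵥ (requestCov w).mulVec t := by
  have := isProbabilityMeasure_balancedRequest hN hw
  rw [variance_eq_sub MemLp.of_discrete, integral_linear_balancedRequest hw,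
    dotProduct_requestCov_mulVec]
  simp only [Pi.pow_apply, integral_linear_sq_balancedRequest hw]

/-! ### Central limit theorem for the request counts -/

/-- The law of an independent sequence of balanced requests. -/
noncomputable def balancedSeq {N : ℕ} (w : Fin N → ℝ) : Measure (ℕ → requestSet N) :=
  Measure.infinitePi fun _ => balancedRequest w

/-- The centred and scaled vector of the weighted numbers of requests in the first `T` slots. -/
noncomputable def scaledCounts {N : ℕ} (w : Fin N → ℝ) (T : ℕ) (ω : ℕ → requestSet N) :
    EuclideanSpace ℝ (Fin N) :=
  WithLp.toLp 2 fun n =>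
    (√(T : ℝ))⁻¹ * (∑ k ∈ Finset.range T, w n * (ω k).1 n - T * (1 / invWeightSum w))

theorem measurable_scaledCounts {N : ℕ} (w : Fin N → ℝ) (T : ℕ) :
    Measurable (scaledCounts w T) := by
  refine (WithLp.measurable_toLp 2 _).comp (measurable_pi_lambda _ fun n => ?_)
  refine ((Finset.measurable_fun_sum _ fun k _ => ?_).sub_const _).const_mul _
  have h : Measurable fun x : requestSet N => x.1 n := Measurable.of_discrete
  exact (h.comp (measurable_pi_apply (X := fun _ : ℕ => requestSet N) k)).const_mul _

theorem inner_scaledCounts {N : ℕ} (w : Fin N → ℝ) (T : ℕ) (ω : ℕ → requestSet N)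
    (t : EuclideanSpace ℝ (Fin N)) :
    inner ℝ (scaledCounts w T ω) t = (√(T : ℝ))⁻¹ *
      (∑ k ∈ Finset.range T, ∑ n, t n * (w n * (ω k).1 n)
        - T * (1 / invWeightSum w * ∑ n, t n)) := by
  rw [Finset.sum_comm]
  simp only [PiLp.inner_apply, scaledCounts, RCLike.inner_apply, conj_trivial, Finset.mul_sum,
    ← Finset.sum_sub_distrib, mul_sub]
  refine Finset.sum_congr rfl fun n _ => ?_
  congr 1
  · exact Finset.sum_congr rfl fun k _ => by ring
  · ring

section BalancedSeq

variable {N : ℕ} {w : Fin N → ℝ}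

theorem isProbabilityMeasure_balancedSeq (hN : 0 < N) (hw : ∀ n, 0 < w n) :
    IsProbabilityMeasure (balancedSeq w) := by
  have := isProbabilityMeasure_balancedRequest hN hw
  unfold balancedSeq; infer_instance

theorem measurePreserving_eval_balancedSeq (hN : 0 < N) (hw : ∀ n, 0 < w n) (k : ℕ) :
    MeasurePreserving (fun ω : ℕ → requestSet N => ω k) (balancedSeq w) (balancedRequest w) := by
  have := isProbabilityMeasure_balancedRequest hN hw
  exact measurePreserving_eval_infinitePi (fun _ => balancedRequest w) k

theorem iIndepFun_balancedSeq (hN : 0 < N) (hw : ∀ n, 0 < w n) :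
    iIndepFun (fun (k : ℕ) (ω : ℕ → requestSet N) => ω k) (balancedSeq w) := by
  have := isProbabilityMeasure_balancedRequest hN hw
  exact iIndepFun_infinitePi (P := fun _ => balancedRequest w) (X := fun _ x => x) (by fun_prop)

theorem tendsto_map_inner_scaledCounts (hN : 0 < N) (hw : ∀ n, 0 < w n)
    (t : EuclideanSpace ℝ (Fin N))
    [IsProbabilityMeasure (balancedSeq w)] :
    TendstoInDistribution (fun (T : ℕ) ω => inner ℝ (scaledCounts w T ω) t) atTop id
      (fun _ => balancedSeq w)
      (gaussianReal 0 (t.ofLp ⬝ᵥ (requestCov w).mulVec t.ofLp).toNNReal) := by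
  have := isProbabilityMeasure_balancedRequest hN hw
  have := isProbabilityMeasure_balancedSeq hN hw
  have hm := fun k => measurable_pi_apply (X := fun _ : ℕ => requestSet N) k
  set g : requestSet N → ℝ := fun x => ∑ n, t n * (w n * x.1 n) with hg
  have hgm : Measurable g := Measurable.of_discrete
  have mp := measurePreserving_eval_balancedSeq hN hw
  have hid : ∀ i, IdentDistrib (fun ω : ℕ → requestSet N => g (ω i)) (fun ω => g (ω 0))
      (balancedSeq w) (balancedSeq w) := fun i => by
    refine IdentDistrib.comp (u := g) ⟨(hm i).aemeasurable, (hm 0).aemeasurable, ?_⟩ hgm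
    rw [(mp i).map_eq, (mp 0).map_eq]
  have hmean : ∫ ω, g (ω 0) ∂(balancedSeq w) = 1 / invWeightSum w * ∑ n, t n := by
    rw [← integral_linear_balancedRequest hw, ← (mp 0).map_eq,
      integral_map (hm 0).aemeasurable (Measurable.of_discrete).aestronglyMeasurable]
  have hvar : Var[fun ω : ℕ → requestSet N => g (ω 0); balancedSeq w] =
      t.ofLp ⬝ᵥ (requestCov w).mulVec t.ofLp := by
    rw [← variance_linear_balancedRequest hN hw, ← (mp 0).map_eq,
      variance_map hgm.aemeasurable (hm 0).aemeasurable]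
    rfl
  have hclt := tendstoInDistribution_inv_sqrt_mul_sum_sub (Y := id)
    (P' := gaussianReal 0 (t.ofLp ⬝ᵥ (requestCov w).mulVec t.ofLp).toNNReal)
    (P := balancedSeq w) (X := fun k ω => g (ω k)) (by rw [hvar]; exact HasLaw.id)
    ((MemLp.of_discrete (f := g) (μ := balancedRequest w)).comp_measurePreserving (mp 0))
    ((iIndepFun_balancedSeq hN hw).comp (fun _ => g) fun _ => hgm) hid
  simp_rw [inner_scaledCounts]
  rw [hmean] at hclt
  exact hclt

/-- The Cramér–Wold device: the characteristic function of a vector at `t` is that of its inner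
product with `t` at `1`, where the one-dimensional limit theorem applies. -/
theorem tendsto_charFun_scaledCounts (hN : 0 < N) (hw : ∀ n, 0 < w n)
    (t : EuclideanSpace ℝ (Fin N)) :
    Tendsto (fun T : ℕ => charFun ((balancedSeq w).map (scaledCounts w T)) t) atTop
      (nhds (charFun (limitGaussian w) t)) := by
  have := isProbabilityMeasure_balancedSeq hN hw
  have h := ProbabilityMeasure.tendsto_iff_tendsto_charFun.1
    (tendsto_map_inner_scaledCounts hN hw t).tendsto (1 : ℝ)
  simp only [ProbabilityMeasure.coe_mk, Measure.map_id] at h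
  convert! h using 1
  · funext T
    rw [charFun_apply, charFun_apply, integral_map, integral_map]
    · simp
    · exact (measurable_scaledCounts w T).inner_const.aemeasurable
    · fun_prop
    · exact (measurable_scaledCounts w T).aemeasurable
    · fun_prop
  · rw [charFun_gaussianReal, limitGaussian,
      charFun_multivariateGaussian (posSemidef_requestCov w hw), Real.coe_toNNReal]
    · simp
    · simpa using (posSemidef_requestCov w hw).dotProduct_mulVec_nonneg t.ofLp

/-- The law of the scaled counts. -/
noncomputable def scaledCountsLaw (hN : 0 < N) (hw : ∀ n, 0 < w n) (T : ℕ) :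
    ProbabilityMeasure (EuclideanSpace ℝ (Fin N)) :=
  ⟨(balancedSeq w).map (scaledCounts w T), by
    have := isProbabilityMeasure_balancedSeq hN hw
    exact Measure.isProbabilityMeasure_map (measurable_scaledCounts w T).aemeasurable⟩

theorem tendsto_scaledCountsLaw (hN : 0 < N) (hw : ∀ n, 0 < w n) :
    Tendsto (scaledCountsLaw hN hw) atTop (nhds ⟨limitGaussian w, inferInstance⟩) :=
  ProbabilityMeasure.tendsto_iff_tendsto_charFun.2 fun t => tendsto_charFun_scaledCounts hN hw t

/-- Variances of independent terms add up, and the factor `T` cancels against the scaling. At `T =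
0` the left side vanishes, whence an inequality. -/
theorem integral_scaledCounts_sq_le (hN : 0 < N) (hw : ∀ n, 0 < w n) (T : ℕ) (n : Fin N) :
    ∫ ω, scaledCounts w T ω n ^ 2 ∂(balancedSeq w) ≤ requestCov w n n := by
  have := isProbabilityMeasure_balancedRequest hN hw
  have := isProbabilityMeasure_balancedSeq hN hw
  have hnn : 0 ≤ requestCov w n n := (posSemidef_requestCov w hw).diag_nonneg
  have hm := fun k => measurable_pi_apply (X := fun _ : ℕ => requestSet N) k
  rcases Nat.eq_zero_or_pos T with rfl | hT
  · simpa [scaledCounts] using hnn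
  have hT0 : (0 : ℝ) < T := by exact_mod_cast hT
  set g : requestSet N → ℝ := fun x => w n * x.1 n with hg
  have hgm : Measurable g := Measurable.of_discrete
  have mp := measurePreserving_eval_balancedSeq hN hw
  have hgt : g = fun x : requestSet N => ∑ m, (Pi.single n 1 : Fin N → ℝ) m * (w m * x.1 m) := by
    funext x
    simp [hg, Pi.single_apply]
  have hmean : ∀ k, ∫ ω, g (ω k) ∂(balancedSeq w) = 1 / invWeightSum w := fun k => by
    have h := integral_map (μ := balancedSeq w) (φ := fun ω => ω k) (f := g) (hm k).aemeasurable
      hgm.aestronglyMeasurable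
    rw [← h, (mp k).map_eq, hgt, integral_linear_balancedRequest hw]
    simp
  have hvar : ∀ k, Var[fun ω => g (ω k); balancedSeq w] = requestCov w n n := fun k => by
    have h := variance_map (μ := balancedSeq w) (X := g) (Y := fun ω => ω k) hgm.aemeasurable
      (hm k).aemeasurable
    change Var[g ∘ fun ω => ω k; balancedSeq w] = _
    rw [← h, (mp k).map_eq, hgt, variance_linear_balancedRequest hN hw]
    simp
  have hL : ∀ k, MemLp (fun ω : ℕ → requestSet N => g (ω k)) 2 (balancedSeq w) := fun k =>
    (MemLp.of_discrete (f := g) (μ := balancedRequest w)).comp_measurePreserving (mp k)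
  have hind := (iIndepFun_balancedSeq hN hw).comp (fun _ => g) fun _ => hgm
  have hsum := IndepFun.variance_sum (X := fun (k : ℕ) (ω : ℕ → requestSet N) => g (ω k))
    (s := Finset.range T) (μ := balancedSeq w) (fun k _ => hL k)
    fun i _ j _ hij => hind.indepFun hij
  have hES : ∫ ω, (∑ k ∈ Finset.range T, fun ω : ℕ → requestSet N => g (ω k)) ω ∂(balancedSeq w)
      = T * (1 / invWeightSum w) := by
    simp only [Finset.sum_apply]
    rw [integral_finsetSum _ fun k _ => (hL k).integrable one_le_two]
    simp [hmean]
  simp only [hvar] at hsum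
  rw [variance_eq_integral (Finset.aemeasurable_sum _ fun k _ => (hL k).aemeasurable), hES] at hsum
  have hz : ∀ ω, scaledCounts w T ω n ^ 2 = (T : ℝ)⁻¹ *
      ((∑ k ∈ Finset.range T, fun ω : ℕ → requestSet N => g (ω k)) ω
        - T * (1 / invWeightSum w)) ^ 2 := fun ω => by
    simp only [scaledCounts, mul_pow, inv_pow, Real.sq_sqrt hT0.le, Finset.sum_apply, hg]
  simp_rw [hz]
  rw [integral_const_mul, hsum]
  simp only [Finset.sum_const, Finset.card_range, nsmul_eq_mul]
  rw [inv_mul_cancel_left₀ hT0.ne']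

end BalancedSeq

/-! ### From weak convergence to convergence of means -/

/-- A continuous function whose second moments are bounded along a weakly convergent sequence:
convergence of the expectations. -/
theorem tendsto_integral_of_integral_sq_le {E : Type*} [MeasurableSpace E] [TopologicalSpace E]
    [OpensMeasurableSpace E] {μs : ℕ → ProbabilityMeasure E} {μ : ProbabilityMeasure E}
    (hμ : Tendsto μs atTop (nhds μ)) {G : E → ℝ} (hG : Continuous G) {K : ℝ}
    (hi : ∀ T, Integrable (fun x => G x ^ 2) (μs T : Measure E))
    (hK : ∀ T, ∫ x, G x ^ 2 ∂(μs T : Measure E) ≤ K)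
    (hi' : Integrable (fun x => G x ^ 2) (μ : Measure E))
    (hK' : ∫ x, G x ^ 2 ∂(μ : Measure E) ≤ K) :
    Tendsto (fun T => ∫ x, G x ∂(μs T : Measure E)) atTop (nhds (∫ x, G x ∂(μ : Measure E))) := by
  -- Truncation at level `M` changes `G` only where `|G| > M`, and there by at most `G ^ 2 / M`; the
  -- error is uniform over the measures.
  have key : ∀ M : ℝ, 0 < M → ∀ ν : ProbabilityMeasure E,
      Integrable (fun x => G x ^ 2) (ν : Measure E) → ∫ x, G x ^ 2 ∂(ν : Measure E) ≤ K →
      |∫ x, G x ∂(ν : Measure E) - ∫ x, max (-M) (min (G x) M) ∂(ν : Measure E)| ≤ K / M := by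
    intro M hM ν h1 h2
    have hGi : Integrable G (ν : Measure E) :=
      ((memLp_two_iff_integrable_sq hG.aestronglyMeasurable).2 h1).integrable one_le_two
    have hci : Integrable (fun x => max (-M) (min (G x) M)) (ν : Measure E) :=
      (integrable_const _).sup (hGi.inf (integrable_const _))
    rw [← integral_sub hGi hci]
    refine abs_integral_le_integral_abs.trans ?_
    have h3 : ∀ x, |G x - max (-M) (min (G x) M)| ≤ G x ^ 2 / M := by
      intro x
      rw [le_div_iff₀ hM]
      rcases le_total (G x) M with h | h
      · rw [min_eq_left h]
        rcases le_total (-M) (G x) with h' | h'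
        · rw [max_eq_right h', sub_self, abs_zero, zero_mul]; positivity
        · rw [max_eq_left h', abs_of_nonpos (by linarith)]; nlinarith
      · rw [min_eq_right h, max_eq_right (by linarith), abs_of_nonneg (by linarith)]; nlinarith
    calc ∫ x, |G x - max (-M) (min (G x) M)| ∂(ν : Measure E)
        ≤ ∫ x, G x ^ 2 / M ∂(ν : Measure E) :=
          integral_mono (hGi.sub hci).abs (h1.div_const M) h3
      _ ≤ K / M := by rw [integral_div]; gcongr
  have hK0 : 0 ≤ K := le_trans (integral_nonneg fun x => sq_nonneg _) hK'
  rw [Metric.tendsto_atTop]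
  intro ε hε
  -- This makes `K / M < ε / 3`; the `+ 1` keeps `M` positive when `K = 0`.
  set M := 3 * (K + 1) / ε with hM
  have hM0 : 0 < M := by positivity
  have hKM : K / M < ε / 3 := by
    rw [div_lt_iff₀ hM0, hM]
    field_simp
    linarith
  let g : BoundedContinuousFunction E ℝ := BoundedContinuousFunction.ofNormedAddCommGroup
    (fun x => max (-M) (min (G x) M)) (by fun_prop) M fun x => by
      rw [Real.norm_eq_abs, abs_le]
      exact ⟨le_max_left _ _, max_le (by linarith) (min_le_right _ _)⟩
  have hg := ProbabilityMeasure.tendsto_iff_forall_integral_tendsto.1 hμ g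
  obtain ⟨T₀, hT₀⟩ := Metric.tendsto_atTop.1 hg (ε / 3) (by positivity)
  refine ⟨T₀, fun T hT => ?_⟩
  have e1 := abs_le.1 (key M hM0 (μs T) (hi T) (hK T))
  have e2 := abs_le.1 (key M hM0 μ hi' hK')
  have e3 := hT₀ T hT
  rw [Real.dist_eq, abs_lt] at e3 ⊢
  simp only [g, BoundedContinuousFunction.coe_ofNormedAddCommGroup] at e3
  constructor <;> linarith [e1.1, e1.2, e2.1, e2.2, e3.1, e3.2]

/-! ### Bounds for utility and regret -/

section Utility

variable {N C : ℕ} {w : Fin N → ℝ}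

theorem utility_nonneg (hw : ∀ n, 0 < w n) (x : requestSet N) (y : cacheSet N C) :
    0 ≤ utility w x y := by
  refine Finset.sum_nonneg fun n _ => mul_nonneg (mul_nonneg (hw n).le ?_) (y.2.1 n).1
  rcases x.2.1 n with h | h <;> simp [h]

theorem utility_le (hw : ∀ n, 0 < w n) (x : requestSet N) (y : cacheSet N C) :
    utility w x y ≤ ∑ n, w n := by
  refine Finset.sum_le_sum fun n _ => ?_
  have hy := y.2.1 n
  have := hw n
  rcases x.2.1 n with h | h
  · rw [h]; simpa using this.le
  · rw [h]; nlinarith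

theorem measurable_utility (w : Fin N → ℝ) :
    Measurable fun p : requestSet N × cacheSet N C => utility w p.1 p.2 := by
  have h1 : ∀ n, Measurable fun x : requestSet N => x.1 n := fun n =>
    (measurable_pi_apply n).comp measurable_subtype_coe
  have h2 : ∀ n, Measurable fun y : cacheSet N C => y.1 n := fun n =>
    (measurable_pi_apply n).comp measurable_subtype_coe
  exact Finset.measurable_fun_sum _ fun n _ =>
    (((h1 n).comp measurable_fst).const_mul _).mul ((h2 n).comp measurable_snd)

theorem sum_utility_mem_Icc (hw : ∀ n, 0 < w n) {T : ℕ} (x : Fin T → requestSet N)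
    (y : Fin T → cacheSet N C) :
    ∑ t, utility w (x t) (y t) ∈ Set.Icc 0 (T * ∑ n, w n) := by
  refine ⟨Finset.sum_nonneg fun t _ => utility_nonneg hw _ _, ?_⟩
  refine (Finset.sum_le_sum fun t _ => utility_le hw _ _).trans ?_
  simp

theorem measurable_sum_utility (w : Fin N → ℝ) (T : ℕ) :
    Measurable fun p : (Fin T → requestSet N) × (Fin T → cacheSet N C) =>
      ∑ t, utility w (p.1 t) (p.2 t) :=
  Finset.measurable_fun_sum _ fun t _ => (measurable_utility w).comp
    (f := fun p : (Fin T → requestSet N) × (Fin T → cacheSet N C) => (p.1 t, p.2 t))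
    (((measurable_pi_apply t).comp measurable_fst).prodMk
      ((measurable_pi_apply t).comp measurable_snd))

theorem bddAbove_range_sum_utility (hw : ∀ n, 0 < w n) {T : ℕ} (x : Fin T → requestSet N) :
    BddAbove (Set.range fun y : cacheSet N C => ∑ t, utility w (x t) y) :=
  ⟨T * ∑ n, w n, by
    rintro _ ⟨y, rfl⟩
    exact (sum_utility_mem_Icc hw x fun _ => y).2⟩

instance nonempty_cacheSet (N C : ℕ) : Nonempty (cacheSet N C) :=
  ⟨⟨0, fun n => by simp, by simp⟩⟩

theorem bestStatic_mem_Icc (hw : ∀ n, 0 < w n) {T : ℕ} (x : Fin T → requestSet N) :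
    bestStatic C w x ∈ Set.Icc 0 (T * ∑ n, w n) :=
  ⟨Real.iSup_nonneg fun y => (sum_utility_mem_Icc hw x fun _ => y).1,
    ciSup_le fun y => (sum_utility_mem_Icc hw x fun _ => y).2⟩

/-- The indicator of `A` is an admissible configuration. -/
theorem sum_le_bestStatic (hw : ∀ n, 0 < w n) {T : ℕ} (x : Fin T → requestSet N)
    (A : Finset (Fin N)) (hA : A.card = C) :
    ∑ n ∈ A, ∑ t, w n * (x t).1 n ≤ bestStatic C w x := by
  classical
  let y : cacheSet N C := ⟨fun n => if n ∈ A then 1 else 0,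
    fun n => by by_cases h : n ∈ A <;> simp [h], by simp [hA]⟩
  refine le_trans (le_of_eq ?_) (le_ciSup (bddAbove_range_sum_utility hw x) y)
  rw [Finset.sum_comm]
  simp [utility, y]

end Utility

section Regret

variable {N C : ℕ} {w : Fin N → ℝ}

instance isProbabilityMeasure_jointLaw (σ : CachingPolicy N C) {T : ℕ}
    (P : ProbabilityMeasure (Fin T → requestSet N)) : IsProbabilityMeasure (σ.jointLaw P) := by
  unfold CachingPolicy.jointLaw; infer_instance

/-- Without this bound the real supremum in `regret` could take its default value and would not
dominate a chosen law. -/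
theorem bddAbove_range_expectedRegret (hw : ∀ n, 0 < w n) (σ : CachingPolicy N C) (T : ℕ) :
    BddAbove (Set.range fun P : ProbabilityMeasure (Fin T → requestSet N) =>
      expectedRegret w σ P) := by
  refine ⟨T * ∑ n, w n, ?_⟩
  rintro _ ⟨P, rfl⟩
  refine (le_abs_self _).trans ?_
  have h := norm_integral_le_of_norm_le_const (μ := σ.jointLaw P) (C := T * ∑ n, w n)
    (f := fun p => bestStatic C w p.1 - ∑ t, utility w (p.1 t) (p.2 t))
    (ae_of_all _ fun p => by
      have h1 := bestStatic_mem_Icc (C := C) hw p.1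
      have h2 := sum_utility_mem_Icc hw p.1 p.2
      rw [Real.norm_eq_abs, abs_le]
      constructor <;> linarith [h1.1, h1.2, h2.1, h2.2])
  simpa [expectedRegret] using h

theorem integrable_sum_utility (hw : ∀ n, 0 < w n) {T : ℕ}
    (ν : Measure ((Fin T → requestSet N) × (Fin T → cacheSet N C))) [IsFiniteMeasure ν] :
    Integrable (fun p => ∑ t, utility w (p.1 t) (p.2 t)) ν :=
  Integrable.of_bound (measurable_sum_utility w T).aestronglyMeasurable (T * ∑ n, w n)
    (ae_of_all _ fun p => by
      have h2 := sum_utility_mem_Icc hw p.1 p.2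
      rw [Real.norm_eq_abs, abs_of_nonneg h2.1]
      exact h2.2)

theorem expectedRegret_eq (hw : ∀ n, 0 < w n) (σ : CachingPolicy N C) {T : ℕ}
    (P : ProbabilityMeasure (Fin T → requestSet N)) :
    expectedRegret w σ P = ∫ x, bestStatic C w x ∂(P : Measure (Fin T → requestSet N)) -
      ∫ p, ∑ t, utility w (p.1 t) (p.2 t) ∂(σ.jointLaw P) := by
  have hb : Measurable fun x : Fin T → requestSet N => bestStatic C w x := Measurable.of_discrete
  have hfst : (σ.jointLaw P).map Prod.fst = P := Measure.fst_compProd _ _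
  have hbi : Integrable (fun p : (Fin T → requestSet N) × (Fin T → cacheSet N C) =>
      bestStatic C w p.1) (σ.jointLaw P) :=
    Integrable.of_bound (hb.comp measurable_fst).aestronglyMeasurable (T * ∑ n, w n)
      (ae_of_all _ fun p => by
        have h2 := bestStatic_mem_Icc (C := C) hw p.1
        rw [Real.norm_eq_abs, abs_of_nonneg h2.1]
        exact h2.2)
  rw [expectedRegret, integral_sub hbi (integrable_sum_utility hw _)]
  congr 1
  conv_rhs => rw [← hfst]
  rw [integral_map measurable_fst.aemeasurable hb.aestronglyMeasurable]

end Regret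

/-! ### Policies facing independent requests -/

section IndependentRequests

variable {N C : ℕ}

theorem measurable_snoc_prod {α : Type*} [MeasurableSpace α] (t : ℕ) :
    Measurable (fun q : (Fin t → α) × α => (Fin.snoc q.1 q.2 : Fin (t + 1) → α)) := by
  refine measurable_pi_lambda _ fun i => ?_
  refine Fin.lastCases ?_ (fun j => ?_) i
  · simpa using measurable_snd
  · simp only [Fin.snoc_castSucc]; fun_prop

theorem measurePreserving_snoc {α : Type*} [MeasurableSpace α] (μ : Measure α) [SigmaFinite μ]
    (t : ℕ) :
    MeasurePreserving (fun q : (Fin t → α) × α => (Fin.snoc q.1 q.2 : Fin (t + 1) → α))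
      ((Measure.pi fun _ => μ).prod μ) (Measure.pi fun _ => μ) := by
  refine ⟨measurable_snoc_prod t, (Measure.pi_eq fun s hs => ?_).symm⟩
  rw [Measure.map_apply (measurable_snoc_prod t) (MeasurableSet.univ_pi hs)]
  have : (fun q : (Fin t → α) × α => (Fin.snoc q.1 q.2 : Fin (t + 1) → α)) ⁻¹' (Set.univ.pi s) =
      (Set.univ.pi fun i : Fin t => s i.castSucc) ×ˢ s (Fin.last t) := by
    ext q
    simp only [Set.mem_preimage, Set.mem_pi, Set.mem_univ, true_implies, Set.mem_prod]
    rw [Fin.forall_fin_succ']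
    simp
  rw [this, Measure.prod_prod, Measure.pi_pi, Fin.prod_univ_castSucc]

/-- Appending the configuration and the request of one more slot to the paths. -/
def appendSlot (T : ℕ) (q : (((Fin T → requestSet N) × (Fin T → cacheSet N C)) ×
    cacheSet N C) × requestSet N) :
    (Fin (T + 1) → requestSet N) × (Fin (T + 1) → cacheSet N C) :=
  (Fin.snoc q.1.1.1 q.2, Fin.snoc q.1.1.2 q.1.2)

theorem measurable_appendSlot (T : ℕ) : Measurable (appendSlot (N := N) (C := C) T) := by
  refine Measurable.prodMk ?_ ?_
  · exact (measurable_snoc_prod T).comp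
      ((measurable_fst.comp (measurable_fst.comp measurable_fst)).prodMk measurable_snd)
  · exact (measurable_snoc_prod T).comp
      ((measurable_snd.comp (measurable_fst.comp measurable_fst)).prodMk
        (measurable_snd.comp measurable_fst))

/-- For independent requests the last request is independent of the past and of the
configuration drawn for it. -/
theorem compProd_configKernel_succ (σ : CachingPolicy N C) (μ : Measure (requestSet N))
    [IsProbabilityMeasure μ] (T : ℕ) :
    have := σ.markov T
    (Measure.pi fun _ : Fin (T + 1) => μ) ⊗ₘ σ.configKernel (T + 1) =
      ((((Measure.pi fun _ : Fin T => μ) ⊗ₘ σ.configKernel T) ⊗ₘ σ.rule T).prod μ).map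
        (appendSlot T) := by
  intro _
  have hmeas := measurable_appendSlot (N := N) (C := C) T
  refine Measure.ext_of_lintegral _ fun f hf => ?_
  rw [Measure.lintegral_compProd hf, lintegral_map hf hmeas,
    -- On both sides the last request is integrated outermost: the configurations do not depend on
    -- it, so the inner integrals can be compared with it fixed.
    lintegral_prod_symm (fun q => f (appendSlot T q)) (hf.comp hmeas).aemeasurable,
    ← (measurePreserving_snoc μ T).map_eq,
    lintegral_map hf.lintegral_kernel_prod_right' (measurable_snoc_prod T),
    lintegral_prod_symm (fun q : (Fin T → requestSet N) × requestSet N =>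
      ∫⁻ y, f ((Fin.snoc q.1 q.2 : Fin (T + 1) → requestSet N), y)
        ∂σ.configKernel (T + 1) (Fin.snoc q.1 q.2 : Fin (T + 1) → requestSet N))
      (hf.lintegral_kernel_prod_right'.comp (measurable_snoc_prod T)).aemeasurable]
  refine lintegral_congr fun x' => ?_
  have hfx : Measurable fun q : ((Fin T → requestSet N) × (Fin T → cacheSet N C)) ×
      cacheSet N C => f (appendSlot T (q, x')) :=
    (hf.comp hmeas).comp (measurable_id.prodMk measurable_const)
  rw [Measure.lintegral_compProd hfx, Measure.lintegral_compProd
    hfx.lintegral_kernel_prod_right']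
  refine lintegral_congr fun x => ?_
  have hfx2 : Measurable fun y : Fin (T + 1) → cacheSet N C =>
      f ((Fin.snoc x x' : Fin (T + 1) → requestSet N), y) := hf.comp (by fun_prop)
  rw [CachingPolicy.configKernel, Kernel.lintegral_map _ (measurable_snoc_config T) _ hfx2,
    Kernel.lintegral_compProd _ _ _ (f := fun q : (Fin T → cacheSet N C) × cacheSet N C =>
      f ((Fin.snoc x x' : Fin (T + 1) → requestSet N), (Fin.snoc q.1 q.2 :
        Fin (T + 1) → cacheSet N C))) (hfx2.comp (measurable_snoc_config T))]
  simp [Kernel.comap_apply, appendSlot]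

/-- Induction on the horizon: given the past and the new configuration `y`, the new request yields
`(∑ n, y n) / S ≤ C / S` on average. -/
theorem integral_sum_utility_balanced_le (hN : 0 < N) {w : Fin N → ℝ} (hw : ∀ n, 0 < w n)
    (σ : CachingPolicy N C) (T : ℕ) :
    ∫ p, ∑ t, utility w (p.1 t) (p.2 t)
      ∂((Measure.pi fun _ : Fin T => balancedRequest w) ⊗ₘ σ.configKernel T) ≤
      T * (C / invWeightSum w) := by
  have := isProbabilityMeasure_balancedRequest hN hw
  have hS := invWeightSum_pos hN hw
  induction T with
  | zero => simp
  | succ T ih =>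
    have := σ.markov T
    set J := (Measure.pi fun _ : Fin T => balancedRequest w) ⊗ₘ σ.configKernel T with hJ
    have hu : ∀ (x : requestSet N) (y : cacheSet N C), ‖utility w x y‖ ≤ ∑ n, w n :=
      fun x y => by
        rw [Real.norm_eq_abs, abs_of_nonneg (utility_nonneg hw x y)]
        exact utility_le hw x y
    rw [compProd_configKernel_succ σ (balancedRequest w) T,
      integral_map (measurable_appendSlot T).aemeasurable
        (measurable_sum_utility w (T + 1)).aestronglyMeasurable]
    simp only [appendSlot, Fin.sum_univ_castSucc, Fin.snoc_castSucc, Fin.snoc_last]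
    have i1 : Integrable (fun q : (((Fin T → requestSet N) × (Fin T → cacheSet N C)) ×
        cacheSet N C) × requestSet N => ∑ t, utility w (q.1.1.1 t) (q.1.1.2 t))
        ((J ⊗ₘ σ.rule T).prod (balancedRequest w)) := by
      have h := integrable_sum_utility hw J
      rw [← Measure.fst_compProd J (σ.rule T)] at h
      exact (h.comp_measurable measurable_fst).comp_fst _
    have hm2 : Measurable (fun q : (((Fin T → requestSet N) × (Fin T → cacheSet N C)) ×
        cacheSet N C) × requestSet N => utility w q.2 q.1.2) :=
      (measurable_utility w).comp
        (measurable_snd.prodMk (measurable_snd.comp measurable_fst))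
    have i2 : Integrable (fun q : (((Fin T → requestSet N) × (Fin T → cacheSet N C)) ×
        cacheSet N C) × requestSet N => utility w q.2 q.1.2)
        ((J ⊗ₘ σ.rule T).prod (balancedRequest w)) :=
      Integrable.of_bound hm2.aestronglyMeasurable _ (ae_of_all _ fun q => hu _ _)
    rw [integral_add i1 i2]
    have e1 : ∫ q, ∑ t, utility w (q.1.1.1 t) (q.1.1.2 t)
        ∂((J ⊗ₘ σ.rule T).prod (balancedRequest w)) =
        ∫ p, ∑ t, utility w (p.1 t) (p.2 t) ∂J := by
      have h1 := integral_map (μ := (J ⊗ₘ σ.rule T).prod (balancedRequest w))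
        (φ := fun q => q.1.1) (by fun_prop)
        (f := fun p => ∑ t, utility w (p.1 t) (p.2 t))
        (measurable_sum_utility w T).aestronglyMeasurable
      rw [← h1]
      congr 1
      have h2 := Measure.map_map (μ := (J ⊗ₘ σ.rule T).prod (balancedRequest w))
        (measurable_fst (α := (Fin T → requestSet N) × (Fin T → cacheSet N C))
          (β := cacheSet N C)) measurable_fst
      refine h2.symm.trans ?_
      change (Measure.fst _).fst = _
      rw [Measure.fst_prod, Measure.fst_compProd]
    have e2 : ∫ q, utility w q.2 q.1.2 ∂((J ⊗ₘ σ.rule T).prod (balancedRequest w)) ≤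
        C / invWeightSum w := by
      rw [integral_prod _ i2]
      have h1 : ∀ q : ((Fin T → requestSet N) × (Fin T → cacheSet N C)) × cacheSet N C,
          ∫ x, utility w x q.2 ∂(balancedRequest w) ≤ C / invWeightSum w := fun q => by
        have h := integral_linear_balancedRequest hw q.2.1
        have h' : ∀ x : requestSet N, utility w x q.2 = ∑ n, q.2.1 n * (w n * x.1 n) :=
          fun x => Finset.sum_congr rfl fun n _ => by ring
        simp_rw [h']
        rw [h, one_div, div_eq_inv_mul]
        exact mul_le_mul_of_nonneg_left q.2.2.2 (inv_nonneg.2 hS.le)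
      refine (integral_mono i2.integral_prod_left (integrable_const _) h1).trans ?_
      simp
    rw [e1]
    push_cast
    linarith

/-- Links the infinite sequence used for the limit theorem with the finite horizon of the regret. -/
theorem map_restrict_balancedSeq (hN : 0 < N) {w : Fin N → ℝ} (hw : ∀ n, 0 < w n) (T : ℕ) :
    (balancedSeq w).map (fun ω (i : Fin T) => ω i) = Measure.pi fun _ => balancedRequest w := by
  have := isProbabilityMeasure_balancedSeq hN hw
  have h := (iIndepFun_balancedSeq hN hw).precomp (g := fun i : Fin T => (i : ℕ))
    Fin.val_injective
  have h' := (iIndepFun_iff_map_fun_eq_pi_map fun i : Fin T =>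
    (measurable_pi_apply (X := fun _ : ℕ => requestSet N) (i : ℕ)).aemeasurable).1 h
  rw [h']
  congr 1
  funext i
  exact (measurePreserving_eval_balancedSeq hN hw i).map_eq

theorem sqrt_mul_topSum_scaledCounts_le (hCN : C ≤ N) {w : Fin N → ℝ} (hw : ∀ n, 0 < w n)
    {T : ℕ} (hT : 0 < T) (ω : ℕ → requestSet N) :
    √(T : ℝ) * topSum hCN (scaledCounts w T ω) + T * (C / invWeightSum w) ≤
      bestStatic C w (fun i : Fin T => ω i) := by
  obtain ⟨A, hA, hs⟩ := exists_sum_eq_topSum hCN (scaledCounts w T ω)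
  -- Each of the `C` files in `A` contributes the centring `T / S`, which accounts for the term `T *
  -- (C / S)`.
  refine le_trans (le_of_eq ?_) (sum_le_bestStatic hw (fun i : Fin T => ω i) A hA)
  have hT0 : √(T : ℝ) ≠ 0 := by positivity
  rw [← hs, Finset.mul_sum]
  simp only [scaledCounts, mul_inv_cancel_left₀ hT0, Finset.sum_sub_distrib, Finset.sum_const, hA,
    Finset.sum_range, nsmul_eq_mul]
  ring

theorem sqrt_mul_integral_topSum_le_regret (hN : 0 < N) (hCN : C ≤ N) {w : Fin N → ℝ}
    (hw : ∀ n, 0 < w n) {T : ℕ} (hT : 0 < T) (σ : CachingPolicy N C)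
    (hi : Integrable (fun ω => topSum hCN (scaledCounts w T ω)) (balancedSeq w)) :
    √(T : ℝ) * ∫ ω, topSum hCN (scaledCounts w T ω) ∂(balancedSeq w) ≤ regret w σ T := by
  have := isProbabilityMeasure_balancedRequest hN hw
  have := isProbabilityMeasure_balancedSeq hN hw
  let P : ProbabilityMeasure (Fin T → requestSet N) :=
    ⟨Measure.pi fun _ => balancedRequest w, inferInstance⟩
  refine le_trans ?_ (le_ciSup (bddAbove_range_expectedRegret hw σ T) P)
  have h1 : ∫ p, ∑ t, utility w (p.1 t) (p.2 t) ∂(σ.jointLaw P) ≤ T * (C / invWeightSum w) :=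
    integral_sum_utility_balanced_le hN hw σ T
  have hr : Measurable fun (ω : ℕ → requestSet N) (i : Fin T) => ω i :=
    measurable_pi_lambda _ fun i => measurable_pi_apply _
  have hb : Measurable fun x : Fin T → requestSet N => bestStatic C w x := Measurable.of_discrete
  have h2 : ∫ x, bestStatic C w x ∂(P : Measure (Fin T → requestSet N)) =
      ∫ ω, bestStatic C w (fun i : Fin T => ω i) ∂(balancedSeq w) := by
    change ∫ x, bestStatic C w x ∂(Measure.pi fun _ => balancedRequest w) = _
    rw [← map_restrict_balancedSeq hN hw T,
      integral_map hr.aemeasurable hb.aestronglyMeasurable]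
  have h3 : ∫ ω, (√(T : ℝ) * topSum hCN (scaledCounts w T ω) + T * (C / invWeightSum w))
      ∂(balancedSeq w) ≤ ∫ ω, bestStatic C w (fun i : Fin T => ω i) ∂(balancedSeq w) := by
    refine integral_mono ((hi.const_mul _).add (integrable_const _)) ?_
      (sqrt_mul_topSum_scaledCounts_le hCN hw hT)
    refine Integrable.of_bound (hb.comp hr).aestronglyMeasurable (T * ∑ n, w n)
      (ae_of_all _ fun ω => ?_)
    have h2 := bestStatic_mem_Icc (C := C) hw (fun i : Fin T => ω i)
    rw [Real.norm_eq_abs, abs_of_nonneg h2.1]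
    exact h2.2
  rw [integral_add (hi.const_mul _) (integrable_const _), integral_const_mul] at h3
  simp only [integral_const, probReal_univ, one_smul] at h3
  rw [expectedRegret_eq hw]
  linarith

end IndependentRequests

/-! ### Passage to the limit and conclusion -/

/-- Only the first `T` requests enter, and they take finitely many values. -/
theorem integrable_scaledCounts_sq {N : ℕ} {w : Fin N → ℝ} (hN : 0 < N) (hw : ∀ n, 0 < w n)
    (T : ℕ) (n : Fin N) :
    Integrable (fun ω => scaledCounts w T ω n ^ 2) (balancedSeq w) := by
  have := isProbabilityMeasure_balancedSeq hN hw
  have hr : Measurable fun (ω : ℕ → requestSet N) (i : Fin T) => ω i :=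
    measurable_pi_lambda _ fun i => measurable_pi_apply _
  let f : (Fin T → requestSet N) → ℝ := fun x =>
    ((√(T : ℝ))⁻¹ * (∑ k, w n * (x k).1 n - T * (1 / invWeightSum w))) ^ 2
  have hf : Integrable f ((balancedSeq w).map fun ω (i : Fin T) => ω i) := Integrable.of_finite
  refine (hf.comp_measurable hr).congr (ae_of_all _ fun ω => ?_)
  simp [f, scaledCounts, Finset.sum_range]

theorem tendsto_integral_topSum_scaledCounts {N C : ℕ} {w : Fin N → ℝ} (hN : 0 < N)
    (hw : ∀ n, 0 < w n) (hCN : C ≤ N) :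
    (∀ T, Integrable (fun ω => topSum hCN (scaledCounts w T ω)) (balancedSeq w)) ∧
    Tendsto (fun T => ∫ ω, topSum hCN (scaledCounts w T ω) ∂(balancedSeq w)) atTop
      (nhds (∫ z, topSum hCN z ∂(limitGaussian w))) := by
  have := isProbabilityMeasure_balancedSeq hN hw
  have hc := continuous_topSum (N := N) hCN
  have hm := measurable_scaledCounts w
  have hsq := integrable_scaledCounts_sq hN hw
  have hsum : ∀ T, Integrable (fun ω => N * ∑ n, scaledCounts w T ω n ^ 2) (balancedSeq w) :=
    fun T => (integrable_finsetSum _ fun n _ => hsq T n).const_mul _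
  have hi : ∀ T, Integrable (fun ω => topSum hCN (scaledCounts w T ω) ^ 2) (balancedSeq w) :=
    fun T => (hsum T).mono' ((hc.pow 2).measurable.comp (hm T)).aestronglyMeasurable
      (ae_of_all _ fun ω => by simpa using topSum_sq_le hCN (scaledCounts w T ω))
  refine ⟨fun T => ((memLp_two_iff_integrable_sq
    (hc.measurable.comp (hm T)).aestronglyMeasurable).2 (hi T)).integrable one_le_two, ?_⟩
  have hmap : ∀ T, ∀ f : EuclideanSpace ℝ (Fin N) → ℝ, Continuous f →
      ∫ z, f z ∂(scaledCountsLaw hN hw T : Measure (EuclideanSpace ℝ (Fin N))) =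
        ∫ ω, f (scaledCounts w T ω) ∂(balancedSeq w) := fun T f hf =>
    integral_map (hm T).aemeasurable hf.aestronglyMeasurable
  have h := tendsto_integral_of_integral_sq_le (tendsto_scaledCountsLaw hN hw) hc
    -- The first entry bounds the second moments along the sequence, the second that of the limit.
    (K := max (N * ∑ n, requestCov w n n) (∫ z, topSum hCN z ^ 2 ∂(limitGaussian w)))
    (fun T => (integrable_map_measure (hc.pow 2).aestronglyMeasurable (hm T).aemeasurable).2 (hi T))
    (fun T => by
      rw [hmap T (fun z => topSum hCN z ^ 2) (hc.pow 2)]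
      refine le_max_of_le_left ?_
      calc _ ≤ ∫ ω, N * ∑ n, scaledCounts w T ω n ^ 2 ∂(balancedSeq w) :=
            integral_mono (hi T) (hsum T) fun ω => topSum_sq_le hCN _
        _ ≤ _ := by
            rw [integral_const_mul, integral_finsetSum _ fun n _ => hsq T n]
            gcongr with n
            exact integral_scaledCounts_sq_le hN hw T n)
    (integrable_topSum_sq hCN w) (le_max_right _ _)
  simp only [hmap _ _ hc] at h
  exact h

theorem eventually_lt_regret {N C : ℕ} {w : Fin N → ℝ} (hN : 0 < N) (hw : ∀ n, 0 < w n)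
    (hCN : C ≤ N) {c : ℝ} (hc : c < ∫ z, topSum hCN z ∂(limitGaussian w)) :
    ∀ᶠ T : ℕ in atTop, ∀ σ : CachingPolicy N C, c * √(T : ℝ) < regret w σ T := by
  obtain ⟨hi, ht⟩ := tendsto_integral_topSum_scaledCounts (C := C) hN hw hCN
  filter_upwards [ht.eventually_const_lt hc, eventually_gt_atTop 0] with T h1 h2 σ
  refine lt_of_lt_of_le ?_ (sqrt_mul_integral_topSum_le_regret hN hCN hw h2 σ (hi T))
  rw [mul_comm]
  have : 0 < √(T : ℝ) := by positivity
  gcongr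

theorem theorem1 (N C : ℕ) (hCN : C < N) (w : Fin N → ℝ) (hw : ∀ n, 0 < w n) :
    (∀ i : Fin N, Integrable (fun z => kthLargest z i) (limitGaussian w)) ∧
    (∀ ε : ℝ, 0 < ε → ∀ᶠ T : ℕ in atTop, ∀ σ : CachingPolicy N C,
      regret w σ T >
        ((∑ i : Fin C, ∫ z, kthLargest z (Fin.castLE hCN.le i) ∂(limitGaussian w)) - ε)
          * √(T : ℝ)) ∧
    (∀ h : 2 * C < N, 0 < C → ∀ᶠ T : ℕ in atTop, ∀ σ : CachingPolicy N C,
      regret w σ T >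
        (Finset.univ.sup' Finset.univ_nonempty (fun φ : Equiv.Perm (Fin N) => pairSum w h φ))
          / √(2 * Real.pi * invWeightSum w) * √(T : ℝ)) := by
  have hN : 0 < N := by omega
  refine ⟨integrable_kthLargest w, fun ε hε => eventually_lt_regret hN hw hCN.le ?_,
    fun h hC => eventually_lt_regret hN hw hCN.le ?_⟩
  · rw [← integral_finsetSum _ fun i _ => integrable_kthLargest w _]
    exact sub_lt_self _ hε
  · obtain ⟨φ, -, hφ⟩ := Finset.exists_mem_eq_sup' Finset.univ_nonempty
      fun φ : Equiv.Perm (Fin N) => pairSum w h φ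
    -- The maximum is attained at `φ`, so the strict inequality is needed for this one permutation
    -- only.
    rw [hφ, ← integral_pairMaxSum h hw φ]
    exact integral_pairMaxSum_lt hCN.le h hC hw φ
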